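/- Conventions. Let $M$ be a cancellative monoid. Write $x\preceq y$ ($x$ divides $y$; $y$ is a multiple of $x$) if $y=xz$ for some $z\in M$, and $x\prec y$ if moreover $z$ is not a unit; put $\mathrm{Div}(x)=\{y : y\preceq x\}$. A subset $S\subseteq M$ *spans* $M$ if it generates $M$, contains $1$, is closed under right multiplication by units, and whenever $x,y\in S$ and $x\preceq z$, $y\preceq z$, there are $x',y'\in S$ with $xy'=yx'\preceq z$. $M$ is *thin* if it has a finite spanning subset; $\Delta\in M$ is a *Garside element* if $\mathrm{Div}(\Delta)$ is a finite spanning subset. An element $x$ is *$\Delta$-simple* if $y\prec x$ implies $\mathrm{Div}(y)\cap\mathrm{Div}(\Delta)\neq\mathrm{Div}(x)\cap\mathrm{Div}(\Delta)$. A finite sequence $(x_1,\dots,x_n)$ is *$\Delta$-normal* if every $x_i$ is $\Delta$-simple and $\mathrm{Div}(x_i)\cap\mathrm{Div}(\Delta)=\mathrm{Div}(x_i\cdots x_n)\cap\mathrm{Div}(\Delta)$ for every $i$. A *$\Delta$-normal form* of $x\in M$ is a (possibly empty) $\Delta$-normal sequence with product $x$ and no entry equal to $1$. A *group of fractions* of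 $M$ is a group $G$ containing $M$ as a submonoid such that every element of $G$ is $xy^{-1}$ with $x,y\in M$; a $\Delta$-normal form of $g\in G$ is a pair $(k,(x_1,\dots,x_p))$ with $k\in\mathbb Z$ and $g=\Delta^{-k}x_1\cdots x_p$, where $(x_1,\dots,x_p)$ is a $\Delta$-normal sequence with no entry equal to $1$ and, if $p\ge1$, $\Delta\not\preceq x_1$. A group $G$ is *automatic* if there are a finite alphabet $A$ with a map $A\to G$ and a regular language $L\subseteq A^*$ whose words represent all elements of $G$, such that for $g=1$ and for the image $g$ in $G$ of each letter of $A$, the set of pairs $(w_1,w_2)\in L\times L$ with $w_1g=w_2$ in $G$ is recognized by a synchronous (padded) two-tape finite automaton. Proposition. Let $M$ be a thin cancellative monoid with no nontrivial unit, let $\Delta$ be a Garside element of $M$, and suppose: if $x\neq x'$ are $\Delta$-simple elements with $\mathrm{Div}(x)\cap\mathrm{Div}(\Delta)=\mathrm{Div}(x')\cap\mathrm{Div}(\Delta)$, then every common multiple of $x$ and $x'$ is a multiple of some $\Delta$-simple common multiple of $x$ and $x'$. Then every element of $M$ has exactly one $\Delta$-normal form. Moreover $M$ has a group of fractions, and,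 for every group of fractions $G$ of $M$ (unique up to isomorphism), $G$ is automatic and, if $M\neq\{1\}$, every element of $G$ has exactly one $\Delta$-normal form. -/

import Mathlib

/-!
In a monoid, Mathlib's `x ∣ y` means `∃ z, y = x * z`, that is, `x` is a left divisor of `y`
(equivalently, `y` is a right multiple of `x`), also when the monoid is not commutative.
-/

universe u v

namespace ThinMonoid

section Monoids

variable {M : Type u} [Monoid M]

/-- `Div x`: the set of all left divisors of `x`. -/
def Div (x : M) : Set M := {y | y ∣ x}

/-- `x` is a proper left divisor of `y`: the quotient is not a unit. -/
def ProperDvd (x y : M) : Prop := ∃ z, ¬ IsUnit z ∧ y = x * z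

/-- The subset `S` spans the monoid `M`. -/
structure Spans (S : Set M) : Prop where
  generates : Submonoid.closure S = ⊤
  one_mem : (1 : M) ∈ S
  mul_unit_mem : ∀ x ∈ S, ∀ w : M, IsUnit w → x * w ∈ S
  common_multiple : ∀ x ∈ S, ∀ y ∈ S, ∀ z : M, x ∣ z → y ∣ z →
    ∃ x' ∈ S, ∃ y' ∈ S, x * y' = y * x' ∧ x * y' ∣ z

variable (M) in
/-- A monoid is thin if it admits a finite spanning subset. -/
def IsThin : Prop := ∃ S : Set M, S.Finite ∧ Spans S

/-- `Δ` is a Garside element if its left divisors form a finite spanning subset. -/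
def IsGarside (Δ : M) : Prop := (Div Δ).Finite ∧ Spans (Div Δ)

/-- `x` is `S`-simple: no proper left divisor of `x` has the same divisors in `S` as `x`. -/
def IsSimple (S : Set M) (x : M) : Prop :=
  ∀ y : M, ProperDvd y x → Div y ∩ S ≠ Div x ∩ S

/-- A sequence `(x₁, …, xₙ)` is `S`-prenormal if, for each `i`, the elements `xᵢ` and `xᵢ ⋯ xₙ`
have the same divisors in `S`. -/
def IsPrenormal (S : Set M) : List M → Prop
  | [] => True
  | x :: l => Div x ∩ S = Div (x :: l).prod ∩ S ∧ IsPrenormal S l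

/-- A sequence is `S`-normal if it is `S`-prenormal and all its entries are `S`-simple. -/
def IsNormal (S : Set M) (l : List M) : Prop :=
  IsPrenormal S l ∧ ∀ x ∈ l, IsSimple S x

/-- `Δ`-simple means `Div Δ`-simple. -/
def IsDeltaSimple (Δ x : M) : Prop := IsSimple (Div Δ) x

/-- `Δ`-normal means `Div Δ`-normal. -/
def IsDeltaNormal (Δ : M) (l : List M) : Prop := IsNormal (Div Δ) l

/-- `l` is a `Δ`-normal form of the element `x` of `M`: a `Δ`-normal decomposition of `x` without
trivial entries. (Without the last clause, entries `1` could always be appended to `l`.) -/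
def IsDeltaNormalForm (Δ x : M) (l : List M) : Prop :=
  l.prod = x ∧ IsDeltaNormal Δ l ∧ (1 : M) ∉ l

/-- The homomorphism `ι` makes `G` a group of (right) fractions of the monoid `M`: it is an
embedding, and every element of `G` is a right fraction of elements of `M`. -/
def IsGroupOfFractions {G : Type v} [Group G] (ι : M →* G) : Prop :=
  Function.Injective ι ∧ ∀ g : G, ∃ x y : M, g = ι x * (ι y)⁻¹

/-- `(k, l)` is a `Δ`-normal form of the element `g` of the group of fractions:
`g = Δ⁻ᵏ x₁ ⋯ xₚ`, where `l = (x₁, …, xₚ)` is a `Δ`-normal sequence without trivial entries whose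
first entry (if any) is not a multiple of `Δ`. -/
def IsGroupDeltaNormalForm {G : Type v} [Group G] (ι : M →* G) (Δ : M) (g : G)
    (p : ℤ × List M) : Prop :=
  g = ι Δ ^ (-p.1) * ι p.2.prod ∧ IsDeltaNormal Δ p.2 ∧ (1 : M) ∉ p.2 ∧
    ∀ x ∈ p.2.head?, ¬ Δ ∣ x

end Monoids

section Automatic

variable {A : Type} {G : Type v} [Group G]

/-- The element of `G` represented by a word over the alphabet `A`, for letters evaluated by `π`. -/
def wordEval (π : A → G) (w : List A) : G := (w.map π).prod

/-- The pair of words `(w₁, w₂)` as a single word over pairs of letters, read synchronously; the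
shorter word is padded at its end with the extra symbol `none`. -/
def paddedPair (w₁ w₂ : List A) : List (Option A × Option A) :=
  List.zipWithAll Prod.mk w₁ w₂

/-- The two-tape language of all padded pairs `(w₁, w₂)` of words in `L` such that the equality
`w₁ g = w₂` holds in `G`. -/
def multiplierLanguage (π : A → G) (L : Language A) (g : G) : Language (Option A × Option A) :=
  {w | ∃ w₁ ∈ L, ∃ w₂ ∈ L, wordEval π w₁ * g = wordEval π w₂ ∧ w = paddedPair w₁ w₂}

variable (G) in
/-- A group is automatic if there are a finite alphabet `A` with an evaluation map `π` into `G` and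
a regular language `L` over `A` that represents every element of `G`, such that equality and right
multiplication by each letter are recognized on `L` by synchronous two-tape finite automata. -/
def IsAutomatic : Prop :=
  ∃ (A : Type) (_ : Fintype A) (π : A → G) (L : Language A),
    L.IsRegular ∧
    (∀ g : G, ∃ w ∈ L, wordEval π w = g) ∧
    (multiplierLanguage π L 1).IsRegular ∧
    ∀ a : A, (multiplierLanguage π L (π a)).IsRegular

end Automatic

end ThinMonoid

/-!
Write `D x` for the set of common left divisors of `x` and `Δ`.

The spanning axiom extends to common multiples of an arbitrary `v` and a divisor `d` of `Δ`: below
any common multiple there is one of the form `v d' = d v'` with `d' ∣ Δ` (`exists_complement`). It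
follows that the left and right divisors of `Δ` coincide, that conjugation by `Δ` is an automorphism
of `M`, and that every element divides a power of `Δ` and has finitely many divisors. In particular
`M` satisfies the Ore conditions on both sides, hence has a group of fractions.

A head of `x` is a `Δ`-simple divisor `h` of `x` with `D h = D x`. Heads exist because `Div x` is
finite. If `x` had two heads, the hypothesis on common multiples would give a `Δ`-simple common
multiple of them that divides `x`, and it would have a proper divisor with the same `D`
(`IsHead.unique`). Splitting off heads gives the existence and uniqueness of normal forms, first in
`M` and then, after extracting the maximal power of `Δ`, in the group of fractions.

For automaticity, `D (v y)` depends only on `v` and `D y` (`Div_mul_inter`). Hence normality is a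
condition on pairs of consecutive entries, and the head of `v y` divides the product of `v` and the
head of `y`. From this one compares the normal forms of `y` and of `s y`, for `s ∣ Δ`: removing the
same number of entries from both leaves `y'` and `c y'` where `c` divides a `Δ`-simple element
(`IsReduced.step`), and there are finitely many of these (`IsDeltaSimple.dvd_Delta_pow`). So normal
forms fellow travel, when read from the right, under left multiplication. Taking inverses turns this
into fellow traveling under right multiplication: the language consists of the words
`xₚ⁻¹ ⋯ x₁⁻¹ Δᵏ`, one for each element `x⁻¹ Δᵏ` of the group, with `(x₁, …, xₚ)` the normal form of
`x` and `k = 0` or `¬ Δ ∣ x`. The elements under which this language fellow travels form a subgroup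
that contains the divisors of `Δ` (`fellowTravels_inv_of_dvd_Delta`), so it is the whole group, and
regularity of the multiplier languages follows by the Myhill–Nerode theorem
(`FellowTravels.isRegular`).
-/

namespace ThinMonoid

/-! ### Divisibility in a monoid with a Garside element -/

section Divisibility

variable {M : Type u} [CancelMonoid M] {Δ : M}

theorem eq_one_of_mul_eq_one (hu : ∀ w : M, IsUnit w → w = 1) {a b : M} (h : a * b = 1) :
    a = 1 ∧ b = 1 := by
  have hb : b * a = 1 := by
    apply mul_left_cancel (a := a)
    rw [← mul_assoc, h, one_mul, mul_one]
  exact ⟨hu a ⟨⟨a, b, h, hb⟩, rfl⟩, hu b ⟨⟨b, a, hb, h⟩, rfl⟩⟩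

theorem dvd_of_mul_dvd_mul_left' {a b c : M} (h : a * b ∣ a * c) : b ∣ c := by
  obtain ⟨d, hd⟩ := h
  rw [mul_assoc] at hd
  exact ⟨d, mul_left_cancel hd⟩

theorem dvd_antisymm_of_units (hu : ∀ w : M, IsUnit w → w = 1) {a b : M} (hab : a ∣ b)
    (hba : b ∣ a) : a = b := by
  obtain ⟨c, rfl⟩ := hab
  obtain ⟨d, hd⟩ := hba
  have h : c * d = 1 := by
    apply mul_left_cancel (a := a)
    rw [← mul_assoc, ← hd, mul_one]
  rw [(eq_one_of_mul_eq_one hu h).1, mul_one]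

theorem properDvd_of_dvd_of_ne (hu : ∀ w : M, IsUnit w → w = 1) {a b : M} (hab : a ∣ b)
    (hne : a ≠ b) : ProperDvd a b := by
  obtain ⟨c, rfl⟩ := hab
  refine ⟨c, fun hc => hne ?_, rfl⟩
  rw [hu c hc, mul_one]

theorem ProperDvd.dvd {a b : M} (h : ProperDvd a b) : a ∣ b :=
  let ⟨c, _, hc⟩ := h
  ⟨c, hc⟩

theorem ProperDvd.ne {a b : M} (h : ProperDvd a b) : a ≠ b := by
  rintro rfl
  obtain ⟨c, hc, h⟩ := h
  exact hc (by rw [left_eq_mul.mp h]; exact isUnit_one)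

theorem Div_subset {a b : M} (h : a ∣ b) : Div a ⊆ Div b := fun _ hc => dvd_trans hc h

theorem IsSimple.eq_of_dvd (hu : ∀ w : M, IsUnit w → w = 1) {S : Set M} {x y : M}
    (hx : IsSimple S x) (hyx : y ∣ x) (h : Div y ∩ S = Div x ∩ S) : y = x := by
  by_contra hne
  exact hx y (properDvd_of_dvd_of_ne hu hyx hne) h

theorem isSimple_one (hu : ∀ w : M, IsUnit w → w = 1) (S : Set M) : IsSimple S 1 := by
  rintro y hy -
  obtain ⟨z, hz⟩ := hy.dvd
  exact hy.ne (eq_one_of_mul_eq_one hu hz.symm).1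

/-- The common multiple axiom, extended from two divisors of `Δ` to an arbitrary element and a
divisor of `Δ`; the complement of the arbitrary element still divides `Δ`. -/
theorem exists_complement (hΔ : IsGarside Δ) (v : M) : ∀ d, d ∣ Δ → ∀ z, v ∣ z → d ∣ z →
    ∃ d' v', d' ∣ Δ ∧ v * d' = d * v' ∧ v * d' ∣ z := by
  have hv : v ∈ Submonoid.closure (Div Δ) := by rw [hΔ.2.generates]; trivial
  induction hv using Submonoid.closure_induction_left with
  | one => exact fun d hd z _ hdz => ⟨d, 1, hd, by simp, by simpa using hdz⟩
  | mul_left s hs v _ ih =>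
    rintro d hd _ ⟨z, rfl⟩ hdz
    obtain ⟨s', -, d₁, hd₁, he, hz⟩ :=
      hΔ.2.common_multiple s hs d hd (s * v * z) (by rw [mul_assoc]; exact dvd_mul_right _ _) hdz
    rw [mul_assoc] at hz ⊢
    obtain ⟨d', v', hd', he', hz'⟩ := ih d₁ hd₁ (v * z) (dvd_mul_right _ _)
      (dvd_of_mul_dvd_mul_left' hz)
    refine ⟨d', s' * v', hd', ?_, ?_⟩
    · rw [mul_assoc, he', ← mul_assoc, he, mul_assoc]
    · rw [mul_assoc]
      exact mul_dvd_mul_left s hz'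

theorem dvd_of_mul_dvd_Delta (hu : ∀ w : M, IsUnit w → w = 1) (hΔ : IsGarside Δ) {a b : M}
    (h : a * b ∣ Δ) : b ∣ Δ := by
  obtain ⟨d, v, hd, he, r, hr⟩ :=
    exists_complement hΔ a (a * b) h (a * b) (dvd_mul_right _ _) dvd_rfl
  have h1 : v * r = 1 := by
    apply mul_left_cancel (a := a * b)
    rw [← mul_assoc, ← he, ← hr, mul_one]
  rw [(eq_one_of_mul_eq_one hu h1).1, mul_one] at he
  rwa [← mul_left_cancel he]

theorem exists_mul_Delta_of_dvd (hu : ∀ w : M, IsUnit w → w = 1) (hΔ : IsGarside Δ) {s : M}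
    (hs : s ∣ Δ) : ∃ s', s' ∣ Δ ∧ s * Δ = Δ * s' := by
  obtain ⟨t, ht⟩ := hs
  obtain ⟨r, hr⟩ := dvd_of_mul_dvd_Delta hu hΔ (dvd_of_eq ht.symm)
  refine ⟨r, dvd_of_mul_dvd_Delta hu hΔ (dvd_of_eq hr.symm), ?_⟩
  rw [hr, ← mul_assoc, ← ht, ← hr]

/-- Every divisor of `Δ` is also a right divisor, because `s ↦ s⁻¹Δ` is an injective self-map of
the finite set of divisors. -/
theorem exists_mul_eq_Delta (hu : ∀ w : M, IsUnit w → w = 1) (hΔ : IsGarside Δ) {s : M}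
    (hs : s ∣ Δ) : ∃ t, t ∣ Δ ∧ t * s = Δ := by
  have hfin : Finite (Div Δ) := hΔ.1
  choose c hc using fun x : Div Δ => x.2
  let f : Div Δ → Div Δ := fun x => ⟨c x, dvd_of_mul_dvd_Delta hu hΔ (dvd_of_eq (hc x).symm)⟩
  have hf : Function.Injective f := by
    intro x y hxy
    have hxy' : c x = c y := congrArg Subtype.val hxy
    have := (hc x).symm.trans (hc y)
    rw [hxy'] at this
    exact Subtype.ext (mul_right_cancel this)
  obtain ⟨t, ht⟩ := Finite.injective_iff_surjective.mp hf ⟨s, hs⟩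
  refine ⟨t, t.2, ?_⟩
  have : c t = s := congrArg Subtype.val ht
  rw [← this]
  exact (hc t).symm

theorem exists_Delta_mul_of_dvd (hu : ∀ w : M, IsUnit w → w = 1) (hΔ : IsGarside Δ) {s : M}
    (hs : s ∣ Δ) : ∃ s', s' ∣ Δ ∧ s' * Δ = Δ * s := by
  obtain ⟨t, ht, hts⟩ := exists_mul_eq_Delta hu hΔ hs
  obtain ⟨r, hr, hrt⟩ := exists_mul_eq_Delta hu hΔ ht
  refine ⟨r, hr, ?_⟩
  nth_rw 1 [← hts]
  rw [← mul_assoc, hrt]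

theorem exists_mul_Delta (hu : ∀ w : M, IsUnit w → w = 1) (hΔ : IsGarside Δ) (x : M) :
    ∃ x', x * Δ = Δ * x' := by
  have hx : x ∈ Submonoid.closure (Div Δ) := by rw [hΔ.2.generates]; trivial
  induction hx using Submonoid.closure_induction_left with
  | one => exact ⟨1, by simp⟩
  | mul_left s hs x _ ih =>
    obtain ⟨x', hx'⟩ := ih
    obtain ⟨s', -, hs'⟩ := exists_mul_Delta_of_dvd hu hΔ hs
    exact ⟨s' * x', by rw [mul_assoc, hx', ← mul_assoc, hs', mul_assoc]⟩

theorem exists_Delta_mul (hu : ∀ w : M, IsUnit w → w = 1) (hΔ : IsGarside Δ) (x : M) :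
    ∃ x', x' * Δ = Δ * x := by
  have hx : x ∈ Submonoid.closure (Div Δ) := by rw [hΔ.2.generates]; trivial
  induction hx using Submonoid.closure_induction_left with
  | one => exact ⟨1, by simp⟩
  | mul_left s hs x _ ih =>
    obtain ⟨x', hx'⟩ := ih
    obtain ⟨s', -, hs'⟩ := exists_Delta_mul_of_dvd hu hΔ hs
    exact ⟨s' * x', by rw [mul_assoc, hx', ← mul_assoc, hs', mul_assoc]⟩

theorem exists_Delta_pow_mul (hu : ∀ w : M, IsUnit w → w = 1) (hΔ : IsGarside Δ) (n : ℕ)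
    (x : M) : ∃ x', x' * Δ ^ n = Δ ^ n * x := by
  induction n generalizing x with
  | zero => exact ⟨x, by simp⟩
  | succ n ih =>
    obtain ⟨y, hy⟩ := exists_Delta_mul hu hΔ x
    obtain ⟨z, hz⟩ := ih y
    exact ⟨z, by rw [pow_succ, ← mul_assoc, hz, mul_assoc, hy, mul_assoc]⟩

theorem exists_Delta_pow_mul_of_dvd (hu : ∀ w : M, IsUnit w → w = 1) (hΔ : IsGarside Δ) (n : ℕ)
    {s : M} (hs : s ∣ Δ) : ∃ s', s' ∣ Δ ∧ s' * Δ ^ n = Δ ^ n * s := by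
  induction n generalizing s with
  | zero => exact ⟨s, hs, by simp⟩
  | succ n ih =>
    obtain ⟨y, hyΔ, hy⟩ := exists_Delta_mul_of_dvd hu hΔ hs
    obtain ⟨z, hzΔ, hz⟩ := ih hyΔ
    exact ⟨z, hzΔ, by rw [pow_succ, ← mul_assoc, hz, mul_assoc, hy, mul_assoc]⟩

theorem dvd_Delta_pow_of_mul_Delta_eq (hu : ∀ w : M, IsUnit w → w = 1) (hΔ : IsGarside Δ)
    {n : ℕ} {x x' : M} (hx : x ∣ Δ ^ n) (h : x * Δ = Δ * x') : x' ∣ Δ ^ n := by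
  obtain ⟨c, hc⟩ := hx
  obtain ⟨c', hc'⟩ := exists_mul_Delta hu hΔ c
  refine ⟨c', mul_left_cancel (a := Δ) ?_⟩
  rw [← mul_assoc, ← h, mul_assoc, ← hc', ← mul_assoc, ← hc, ← pow_succ, ← pow_succ']

theorem mul_dvd_Delta_pow_succ (hu : ∀ w : M, IsUnit w → w = 1) (hΔ : IsGarside Δ)
    {n : ℕ} {x s : M} (hx : x ∣ Δ ^ n) (hs : s ∣ Δ) : x * s ∣ Δ ^ (n + 1) := by
  obtain ⟨x', hx'⟩ := exists_mul_Delta hu hΔ x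
  refine (mul_dvd_mul_left x hs).trans ?_
  rw [hx', pow_succ']
  exact mul_dvd_mul_left Δ (dvd_Delta_pow_of_mul_Delta_eq hu hΔ hx hx')

theorem exists_dvd_Delta_pow (hu : ∀ w : M, IsUnit w → w = 1) (hΔ : IsGarside Δ) (x : M) :
    ∃ n : ℕ, x ∣ Δ ^ n := by
  have hx : x ∈ Submonoid.closure (Div Δ) := by rw [hΔ.2.generates]; trivial
  induction hx using Submonoid.closure_induction_right with
  | one => exact ⟨0, one_dvd _⟩
  | mul_right x _ s hs ih =>
    obtain ⟨n, hn⟩ := ih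
    exact ⟨n + 1, mul_dvd_Delta_pow_succ hu hΔ hn hs⟩

theorem exists_mul_eq_Delta_pow (hu : ∀ w : M, IsUnit w → w = 1) (hΔ : IsGarside Δ) (x : M) :
    ∃ (n : ℕ) (c : M), c * x = Δ ^ n := by
  obtain ⟨n, c, hc⟩ := exists_dvd_Delta_pow hu hΔ x
  obtain ⟨d, hd⟩ := exists_Delta_pow_mul hu hΔ n c
  refine ⟨n, d, mul_right_cancel (b := c) ?_⟩
  rw [mul_assoc, ← hc, hd]

theorem finite_Div_Delta_pow (hΔ : IsGarside Δ) (n : ℕ) (hu : ∀ w : M, IsUnit w → w = 1) :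
    (Div (Δ ^ n)).Finite := by
  induction n with
  | zero =>
    refine (Set.finite_singleton (1 : M)).subset ?_
    rintro x ⟨y, hy⟩
    rw [pow_zero] at hy
    exact (eq_one_of_mul_eq_one hu hy.symm).1
  | succ n ih =>
    -- A divisor `x` of `Δⁿ⁺¹` satisfies `x d = Δ v` with `d ∣ Δ` and `v ∣ Δⁿ`, and the pair
    -- `(d, v)` determines `x`.
    have key : ∀ x : Div (Δ ^ (n + 1)), ∃ p : Div Δ × Div (Δ ^ n), x.1 * p.1 = Δ * p.2 := by
      rintro ⟨x, hx⟩
      obtain ⟨d, v, hd, he, hz⟩ := exists_complement hΔ x Δ dvd_rfl _ hx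
        (dvd_pow_self Δ n.succ_ne_zero)
      rw [he, pow_succ'] at hz
      exact ⟨⟨⟨d, hd⟩, v, dvd_of_mul_dvd_mul_left' hz⟩, he⟩
    choose f hf using key
    have : Finite (Div Δ) := hΔ.1
    have : Finite (Div (Δ ^ n)) := ih
    refine Finite.of_injective f fun x y hxy => Subtype.ext ?_
    have hx := hf x
    rw [hxy, ← hf y] at hx
    exact mul_right_cancel hx

theorem finite_Div (hu : ∀ w : M, IsUnit w → w = 1) (hΔ : IsGarside Δ) (x : M) :
    (Div x).Finite := by
  obtain ⟨n, hn⟩ := exists_dvd_Delta_pow hu hΔ x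
  exact (finite_Div_Delta_pow hΔ n hu).subset (Div_subset hn)

theorem ncard_Div_lt (hu : ∀ w : M, IsUnit w → w = 1) (hΔ : IsGarside Δ) {x y : M}
    (h : ProperDvd y x) : (Div y).ncard < (Div x).ncard :=
  Set.ncard_lt_ncard ⟨Div_subset h.dvd, fun hxy =>
    h.ne (dvd_antisymm_of_units hu h.dvd (hxy (dvd_refl x)))⟩ (finite_Div hu hΔ x)

theorem ncard_Div_lt_mul (hu : ∀ w : M, IsUnit w → w = 1) (hΔ : IsGarside Δ) {a : M}
    (ha : a ≠ 1) (x : M) : (Div x).ncard < (Div (a * x)).ncard := by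
  rw [← Set.ncard_image_of_injective (Div x) (mul_right_injective a)]
  refine Set.ncard_lt_ncard ⟨?_, fun h => ?_⟩ (finite_Div hu hΔ _)
  · rintro _ ⟨y, hy, rfl⟩
    exact mul_dvd_mul_left a hy
  · obtain ⟨y, -, hy⟩ := h (one_dvd (a * x))
    exact ha (eq_one_of_mul_eq_one hu hy).1

theorem Delta_ne_one [Nontrivial M] (hu : ∀ w : M, IsUnit w → w = 1) (hΔ : IsGarside Δ) :
    Δ ≠ 1 := by
  rintro rfl
  obtain ⟨x, hx⟩ := exists_ne (1 : M)
  obtain ⟨n, y, hy⟩ := exists_dvd_Delta_pow hu hΔ x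
  rw [one_pow] at hy
  exact hx (eq_one_of_mul_eq_one hu hy.symm).1

theorem Delta_not_dvd_one [Nontrivial M] (hu : ∀ w : M, IsUnit w → w = 1) (hΔ : IsGarside Δ) :
    ¬ Δ ∣ 1 := fun ⟨_, hy⟩ => Delta_ne_one hu hΔ (eq_one_of_mul_eq_one hu hy.symm).1

theorem exists_eq_Delta_pow_mul [Nontrivial M] (hu : ∀ w : M, IsUnit w → w = 1)
    (hΔ : IsGarside Δ) (x : M) : ∃ (n : ℕ) (y : M), x = Δ ^ n * y ∧ ¬ Δ ∣ y := by
  induction h : (Div x).ncard using Nat.strong_induction_on generalizing x with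
  | _ m ih =>
    by_cases hx : Δ ∣ x
    · obtain ⟨y, rfl⟩ := hx
      obtain ⟨n, z, hz, hz'⟩ :=
        ih _ (h ▸ ncard_Div_lt_mul hu hΔ (Delta_ne_one hu hΔ) y) y rfl
      exact ⟨n + 1, z, by rw [pow_succ', mul_assoc, ← hz], hz'⟩
    · exact ⟨0, x, by simp, hx⟩

end Divisibility

/-! ### Heads and normal forms -/

section NormalForms

variable {M : Type u} [CancelMonoid M] {Δ : M}

/-- `h` is a head of `x`: a `Δ`-simple left divisor of `x` with the same divisors in `Div Δ`. -/
structure IsHead (Δ h x : M) : Prop where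
  dvd : h ∣ x
  simple : IsDeltaSimple Δ h
  div_eq : Div h ∩ Div Δ = Div x ∩ Div Δ

/-- The hypothesis on common multiples of `Δ`-simple elements. -/
def SimpleCommonMultiples (Δ : M) : Prop :=
  ∀ x x' : M, IsDeltaSimple Δ x → IsDeltaSimple Δ x' → x ≠ x' →
    Div x ∩ Div Δ = Div x' ∩ Div Δ → ∀ z : M, x ∣ z → x' ∣ z →
      ∃ w : M, IsDeltaSimple Δ w ∧ x ∣ w ∧ x' ∣ w ∧ w ∣ z

theorem exists_isHead (hu : ∀ w : M, IsUnit w → w = 1) (hΔ : IsGarside Δ) (x : M) :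
    ∃ h, IsHead Δ h x := by
  induction hn : (Div x).ncard using Nat.strong_induction_on generalizing x with
  | _ n ih =>
    by_cases hx : IsDeltaSimple Δ x
    · exact ⟨x, dvd_rfl, hx, rfl⟩
    · simp only [IsDeltaSimple, IsSimple, not_forall, not_not] at hx
      obtain ⟨y, hyx, he⟩ := hx
      obtain ⟨h, hh⟩ := ih _ (hn ▸ ncard_Div_lt hu hΔ hyx) y rfl
      exact ⟨h, hh.dvd.trans hyx.dvd, hh.simple, hh.div_eq.trans he⟩

/-- Two distinct heads of `x` would have a `Δ`-simple common multiple dividing `x`; as it has the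
same divisors in `Div Δ`, it would not be simple. -/
theorem IsHead.unique (hu : ∀ w : M, IsUnit w → w = 1) (hc : SimpleCommonMultiples Δ)
    {h h' x : M} (hh : IsHead Δ h x) (hh' : IsHead Δ h' x) : h = h' := by
  by_contra hne
  have he := hh.div_eq.trans hh'.div_eq.symm
  obtain ⟨w, hw, hhw, hhw', hwx⟩ := hc h h' hh.simple hh'.simple hne he x hh.dvd hh'.dvd
  have hwD : Div h ∩ Div Δ = Div w ∩ Div Δ :=
    (Set.inter_subset_inter_left _ (Div_subset hhw)).antisymm
      (hh.div_eq ▸ Set.inter_subset_inter_left _ (Div_subset hwx))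
  exact hne ((hw.eq_of_dvd hu hhw hwD).trans (hw.eq_of_dvd hu hhw' (he ▸ hwD)).symm)

theorem IsHead.one_of_one (hu : ∀ w : M, IsUnit w → w = 1) : IsHead Δ (1 : M) 1 :=
  ⟨dvd_rfl, isSimple_one hu _, rfl⟩

theorem IsHead.ne_one (hΔ : IsGarside Δ) {h x : M} (hh : IsHead Δ h x)
    (hu : ∀ w : M, IsUnit w → w = 1) (hx : x ≠ 1) : h ≠ 1 := by
  rintro rfl
  have hmem : x ∈ Submonoid.closure (Div Δ) := by rw [hΔ.2.generates]; trivial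
  induction hmem using Submonoid.closure_induction_left with
  | one => exact hx rfl
  | mul_left s hs y _ ih =>
    have hs1 : s ∈ Div (1 : M) ∩ Div Δ := hh.div_eq ▸ ⟨dvd_mul_right s y, hs⟩
    obtain ⟨t, ht⟩ := hs1.1
    obtain rfl := (eq_one_of_mul_eq_one hu ht.symm).1
    rw [one_mul] at hh hx
    exact ih hx hh

/-- The divisors in `Div Δ` of a product `v y` only depend on `v` and on the divisors in `Div Δ`
of `y`. -/
theorem Div_mul_inter (hΔ : IsGarside Δ) (v : M) {h y : M} (hy : h ∣ y)
    (he : Div h ∩ Div Δ = Div y ∩ Div Δ) : Div (v * h) ∩ Div Δ = Div (v * y) ∩ Div Δ := by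
  refine (Set.inter_subset_inter_left _ (Div_subset (mul_dvd_mul_left v hy))).antisymm ?_
  rintro d ⟨hd, hdΔ⟩
  obtain ⟨d', v', hd', he', hz⟩ := exists_complement hΔ v d hdΔ (v * y) (dvd_mul_right _ _) hd
  have : d' ∈ Div h ∩ Div Δ := he ▸ ⟨dvd_of_mul_dvd_mul_left' hz, hd'⟩
  exact ⟨(Dvd.intro v' he'.symm).trans (mul_dvd_mul_left v this.1), hdΔ⟩

/-- The head of `v y` divides the product of `v` and the head of `y`. -/
theorem IsHead.dvd_mul (hu : ∀ w : M, IsUnit w → w = 1) (hΔ : IsGarside Δ)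
    (hc : SimpleCommonMultiples Δ) {v y h k : M} (hh : IsHead Δ h (v * y)) (hky : k ∣ y)
    (hk : Div k ∩ Div Δ = Div y ∩ Div Δ) : h ∣ v * k := by
  obtain ⟨h', hh'⟩ := exists_isHead hu hΔ (v * k)
  have : IsHead Δ h' (v * y) := ⟨hh'.dvd.trans (mul_dvd_mul_left v hky), hh'.simple,
    hh'.div_eq.trans (Div_mul_inter hΔ v hky hk)⟩
  rw [hh.unique hu hc this]
  exact hh'.dvd

/-- A `Δ`-simple element is a minimal common multiple of its divisors in `Div Δ`, so that it
divides a fixed power of `Δ`. -/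
theorem IsDeltaSimple.dvd_Delta_pow (hu : ∀ w : M, IsUnit w → w = 1) (hΔ : IsGarside Δ) {x : M}
    (hx : IsDeltaSimple Δ x) : x ∣ Δ ^ (Div Δ).ncard := by
  have key : ∀ T : Finset M, (T : Set M) ⊆ Div x ∩ Div Δ →
      ∃ w, w ∣ x ∧ w ∣ Δ ^ T.card ∧ ∀ t ∈ T, t ∣ w := by
    classical
    intro T
    induction T using Finset.induction_on with
    | empty => exact fun _ => ⟨1, one_dvd _, one_dvd _, by simp⟩
    | insert a T ha ih =>
      intro hT
      rw [Finset.coe_insert, Set.insert_subset_iff] at hT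
      obtain ⟨w, hwx, hwΔ, hw⟩ := ih hT.2
      obtain ⟨d, v, hd, he, hz⟩ := exists_complement hΔ w a hT.1.2 x hwx hT.1.1
      refine ⟨w * d, hz, ?_, ?_⟩
      · rw [Finset.card_insert_of_notMem ha]
        exact mul_dvd_Delta_pow_succ hu hΔ hwΔ hd
      · intro t ht
        rcases Finset.mem_insert.mp ht with rfl | ht
        · exact Dvd.intro v he.symm
        · exact (hw t ht).trans (dvd_mul_right _ _)
  have hfin : (Div x ∩ Div Δ).Finite := hΔ.1.subset Set.inter_subset_right
  obtain ⟨w, hwx, hwΔ, hw⟩ := key hfin.toFinset (by simp)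
  have hwx' : w = x := by
    refine hx.eq_of_dvd hu hwx ((Set.inter_subset_inter_left _ (Div_subset hwx)).antisymm ?_)
    exact fun t ht => ⟨hw t (hfin.mem_toFinset.mpr ht), ht.2⟩
  rw [← hwx']
  refine hwΔ.trans (pow_dvd_pow Δ ?_)
  rw [← Set.ncard_eq_toFinset_card _ hfin]
  exact Set.ncard_le_ncard Set.inter_subset_right hΔ.1

theorem finite_isDeltaSimple (hu : ∀ w : M, IsUnit w → w = 1) (hΔ : IsGarside Δ) :
    {x : M | IsDeltaSimple Δ x}.Finite :=
  (finite_Div_Delta_pow hΔ _ hu).subset fun _ hx => hx.dvd_Delta_pow hu hΔ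

/-- A list is reduced normal if it is the `Δ`-normal form of its product. -/
def IsReduced (Δ : M) (l : List M) : Prop := IsDeltaNormal Δ l ∧ (1 : M) ∉ l

theorem isReduced_nil : IsReduced Δ ([] : List M) :=
  ⟨⟨trivial, by simp⟩, by simp⟩

theorem isReduced_cons {x : M} {l : List M} :
    IsReduced Δ (x :: l) ↔ IsHead Δ x (x * l.prod) ∧ x ≠ 1 ∧ IsReduced Δ l := by
  simp only [IsReduced, IsDeltaNormal, IsNormal, IsPrenormal, List.prod_cons, List.mem_cons, not_or,
    forall_eq_or_imp]
  constructor
  · rintro ⟨⟨⟨h1, h2⟩, h3, h4⟩, h5, h6⟩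
    exact ⟨⟨dvd_mul_right _ _, h3, h1⟩, Ne.symm h5, ⟨h2, h4⟩, h6⟩
  · rintro ⟨⟨-, h3, h1⟩, h5, ⟨h2, h4⟩, h6⟩
    exact ⟨⟨⟨h1, h2⟩, h3, h4⟩, Ne.symm h5, h6⟩

theorem IsReduced.tail {l : List M} (hl : IsReduced Δ l) : IsReduced Δ l.tail := by
  cases l with
  | nil => exact hl
  | cons x l => exact (isReduced_cons.mp hl).2.2

theorem IsReduced.drop {l : List M} (hl : IsReduced Δ l) (i : ℕ) : IsReduced Δ (l.drop i) := by
  induction i generalizing l with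
  | zero => simpa using hl
  | succ i ih => rw [← List.drop_tail]; exact ih hl.tail

theorem headD_mul_prod_tail (l : List M) : l.headD 1 * l.tail.prod = l.prod := by
  cases l <;> simp

theorem IsReduced.isHead (hu : ∀ w : M, IsUnit w → w = 1) {l : List M} (hl : IsReduced Δ l) :
    IsHead Δ (l.headD 1) l.prod := by
  cases l with
  | nil => exact IsHead.one_of_one hu
  | cons x l => exact (isReduced_cons.mp hl).1

theorem IsReduced.eq_nil (hu : ∀ w : M, IsUnit w → w = 1) {l : List M} (hl : IsReduced Δ l)
    (h : l.prod = 1) : l = [] := by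
  cases l with
  | nil => rfl
  | cons x l => exact absurd (eq_one_of_mul_eq_one hu h).1 (isReduced_cons.mp hl).2.1

theorem exists_isReduced (hu : ∀ w : M, IsUnit w → w = 1) (hΔ : IsGarside Δ) (x : M) :
    ∃ l : List M, IsReduced Δ l ∧ l.prod = x := by
  induction hn : (Div x).ncard using Nat.strong_induction_on generalizing x with
  | _ n ih =>
    by_cases hx : x = 1
    · exact ⟨[], isReduced_nil, hx.symm⟩
    · obtain ⟨h, hh⟩ := exists_isHead hu hΔ x
      have h1 := hh.ne_one hΔ hu hx
      obtain ⟨y, rfl⟩ := hh.dvd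
      obtain ⟨l, hl, rfl⟩ := ih _ (hn ▸ ncard_Div_lt_mul hu hΔ h1 y) y rfl
      exact ⟨h :: l, isReduced_cons.mpr ⟨hh, h1, hl⟩, rfl⟩

theorem IsReduced.unique (hu : ∀ w : M, IsUnit w → w = 1) (hc : SimpleCommonMultiples Δ)
    {l m : List M} (hl : IsReduced Δ l) (hm : IsReduced Δ m) (h : l.prod = m.prod) : l = m := by
  induction l generalizing m with
  | nil => exact (hm.eq_nil hu h.symm).symm
  | cons x l ih =>
    cases m with
    | nil => exact hl.eq_nil hu h
    | cons y m =>
      have hx := hl.isHead hu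
      rw [h] at hx
      obtain rfl : x = y := hx.unique hu hc (hm.isHead hu)
      exact congrArg _ (ih hl.tail hm.tail (mul_left_cancel h))

theorem Delta_dvd_headD_iff (hu : ∀ w : M, IsUnit w → w = 1) {l : List M} (hl : IsReduced Δ l) :
    Δ ∣ l.headD 1 ↔ Δ ∣ l.prod := by
  have h := Set.ext_iff.mp (hl.isHead hu).div_eq Δ
  simpa [Div] using h

theorem existsUnique_isDeltaNormalForm (hu : ∀ w : M, IsUnit w → w = 1) (hΔ : IsGarside Δ)
    (hc : SimpleCommonMultiples Δ) (x : M) : ∃! l : List M, IsDeltaNormalForm Δ x l := by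
  obtain ⟨l, hl, hlx⟩ := exists_isReduced hu hΔ x
  exact ⟨l, ⟨hlx, hl⟩, fun m hm => IsReduced.unique hu hc hm.2 hl (hm.1.trans hlx.symm)⟩

/-! ### Left multiplication of normal forms -/

/-- One step of the comparison of the normal forms of `y` and `s y`: if `s` divides the head of
`s y`, removing the heads of `y` and of `s y` leaves elements in the same relation. -/
theorem IsReduced.step (hu : ∀ w : M, IsUnit w → w = 1) (hΔ : IsGarside Δ)
    (hc : SimpleCommonMultiples Δ) {l m : List M} (hl : IsReduced Δ l) (hm : IsReduced Δ m) {s : M}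
    (h : m.prod = s * l.prod) (hs : s ∣ m.headD 1) :
    ∃ s', m.tail.prod = s' * l.tail.prod ∧ s' ∣ m.tail.headD 1 := by
  have hlh := hl.isHead hu
  have hmh := hm.isHead hu
  have hmt := hm.tail.isHead hu
  obtain ⟨e, he⟩ := hs
  -- The head of `s y` divides `s x₁`, where `x₁` is the head of `y`; so `x₁ = e s'`.
  rw [h] at hmh
  have h1 := hmh.dvd_mul hu hΔ hc hlh.dvd hlh.div_eq
  rw [he] at h1
  obtain ⟨s', hs'⟩ := dvd_of_mul_dvd_mul_left' h1
  have h2 : l.prod = e * m.tail.prod := by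
    apply mul_left_cancel (a := s)
    rw [← h, ← headD_mul_prod_tail m, he, mul_assoc]
  refine ⟨s', ?_, ?_⟩
  · apply mul_left_cancel (a := e)
    rw [← h2, ← mul_assoc, ← hs', headD_mul_prod_tail]
  · rw [h2] at hlh
    have h3 := hlh.dvd_mul hu hΔ hc hmt.dvd hmt.div_eq
    rw [hs'] at h3
    exact dvd_of_mul_dvd_mul_left' h3

theorem IsReduced.exists_drop (hu : ∀ w : M, IsUnit w → w = 1) (hΔ : IsGarside Δ)
    (hc : SimpleCommonMultiples Δ) (i : ℕ) {l m : List M} (hl : IsReduced Δ l)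
    (hm : IsReduced Δ m) {s : M} (h : m.prod = s * l.prod) (hs : s ∣ m.headD 1) :
    ∃ c, (m.drop i).prod = c * (l.drop i).prod ∧ c ∣ (m.drop i).headD 1 := by
  induction i generalizing l m s with
  | zero => exact ⟨s, h, hs⟩
  | succ i ih =>
    obtain ⟨s', h', hs'⟩ := hl.step hu hΔ hc hm h hs
    simpa using ih hl.tail hm.tail h' hs'

theorem IsReduced.length_le (hu : ∀ w : M, IsUnit w → w = 1) (hΔ : IsGarside Δ)
    (hc : SimpleCommonMultiples Δ) {l m : List M} (hl : IsReduced Δ l)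
    (hm : IsReduced Δ m) {s : M} (h : m.prod = s * l.prod) (hs : s ∣ m.headD 1) :
    l.length ≤ m.length ∧ m.length ≤ l.length + 1 := by
  constructor
  · obtain ⟨c, hc1, -⟩ := hl.exists_drop hu hΔ hc m.length hm h hs
    rw [List.drop_length, List.prod_nil] at hc1
    simpa using (hl.drop m.length).eq_nil hu (eq_one_of_mul_eq_one hu hc1.symm).2
  · obtain ⟨c, hc1, r, hr⟩ := hl.exists_drop hu hΔ hc l.length hm h hs
    rw [List.drop_length, List.prod_nil, mul_one, ← headD_mul_prod_tail, hr, mul_assoc] at hc1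
    have h1 := (eq_one_of_mul_eq_one hu (mul_left_cancel (hc1.trans (mul_one c).symm))).2
    have h2 := (hm.drop l.length).tail.eq_nil hu h1
    simpa using h2

/-- Fellow traveling of the normal forms `l` of `y` and `m` of `s y`, where `s ∣ Δ`: their
tails differ by left factors dividing a fixed power of `Δ`. -/
theorem IsReduced.exists_drop_of_dvd_Delta (hu : ∀ w : M, IsUnit w → w = 1) (hΔ : IsGarside Δ)
    (hc : SimpleCommonMultiples Δ) {l m : List M} (hl : IsReduced Δ l)
    (hm : IsReduced Δ m) {s : M} (h : m.prod = s * l.prod) (hs : s ∣ Δ) :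
    (l.length ≤ m.length ∧ m.length ≤ l.length + 1) ∧
    ∀ i, ∃ c, (m.drop i).prod = c * (l.drop i).prod ∧ c ∣ Δ ^ (Div Δ).ncard := by
  have hs' : s ∣ m.headD 1 := by
    have : s ∈ Div (m.headD 1) ∩ Div Δ := by
      rw [(hm.isHead hu).div_eq]
      exact ⟨Dvd.intro _ h.symm, hs⟩
    exact this.1
  refine ⟨hl.length_le hu hΔ hc hm h hs', fun i => ?_⟩
  obtain ⟨c, h1, h2⟩ := hl.exists_drop hu hΔ hc i hm h hs'
  exact ⟨c, h1, h2.trans (((hm.drop i).isHead hu).simple.dvd_Delta_pow hu hΔ)⟩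

/-- Normality of a list only depends on its pairs of consecutive entries. -/
theorem isReduced_cons_cons_of_head (hu : ∀ w : M, IsUnit w → w = 1) (hΔ : IsGarside Δ) {x y : M}
    {l l' : List M} (h : IsReduced Δ (x :: y :: l)) (h' : IsReduced Δ (y :: l')) :
    IsReduced Δ (x :: y :: l') := by
  rw [isReduced_cons] at h ⊢
  refine ⟨⟨dvd_mul_right _ _, h.1.simple, ?_⟩, h.2.1, h'⟩
  have h1 := (h.2.2.isHead hu)
  have h2 := (h'.isHead hu)
  rw [h.1.div_eq, ← Div_mul_inter hΔ x h1.dvd h1.div_eq, ← Div_mul_inter hΔ x h2.dvd h2.div_eq]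
  rfl

end NormalForms

/-! ### Groups of fractions -/

section Fractions

variable {M : Type u} [CancelMonoid M] {Δ : M}

/-- The powers of `Δ` provide common multiples on both sides, so that the Ore localization of `M`
at all its elements is a group of fractions. -/
theorem exists_groupOfFractions (hu : ∀ w : M, IsUnit w → w = 1) (hΔ : IsGarside Δ) :
    ∃ (G : Type u) (_ : Group G) (ι : M →* G), IsGroupOfFractions ι := by
  have hcm : ∀ a b : M, ∃ c d : M, a * c = b * d := by
    intro a b
    obtain ⟨m, c, hc⟩ := exists_dvd_Delta_pow hu hΔ a
    obtain ⟨n, d, hd⟩ := exists_dvd_Delta_pow hu hΔ b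
    refine ⟨c * Δ ^ n, d * Δ ^ m, ?_⟩
    rw [← mul_assoc, ← mul_assoc, ← hc, ← hd, ← pow_add, ← pow_add, add_comm]
  have hcm' : ∀ (a : M) (b : (⊤ : Submonoid M)), ∃ p : M × (⊤ : Submonoid M),
      (p.2 : M) * a = p.1 * b := by
    intro a b
    obtain ⟨m, c, hc⟩ := exists_mul_eq_Delta_pow hu hΔ a
    obtain ⟨n, d, hd⟩ := exists_mul_eq_Delta_pow hu hΔ (b : M)
    refine ⟨(Δ ^ m * d, ⟨Δ ^ n * c, trivial⟩), ?_⟩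
    simp only [mul_assoc, hc, hd, ← pow_add, add_comm]
  choose f hf using hcm'
  let : OreLocalization.OreSet (⊤ : Submonoid M) :=
    { ore_right_cancel := fun r₁ r₂ s h => ⟨1, by rw [mul_right_cancel h]⟩
      oreNum := fun r s => (f r s).1
      oreDenom := fun r s => (f r s).2
      ore_eq := hf }
  have hunit : ∀ g : OreLocalization (⊤ : Submonoid M) M, IsUnit g := by
    intro g
    induction g with
    | _ r s =>
    exact ⟨⟨_, _, OreLocalization.mul_inv ⟨r, Submonoid.mem_top r⟩ s,
      OreLocalization.mul_inv s ⟨r, Submonoid.mem_top r⟩⟩, rfl⟩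
  let : Group (OreLocalization (⊤ : Submonoid M) M) := groupOfIsUnit hunit
  have hmul : ∀ a : M, ∀ s : (⊤ : Submonoid M),
      (OreLocalization.numeratorHom (s : M) : OreLocalization (⊤ : Submonoid M) M) *
        OreLocalization.oreDiv a s = OreLocalization.numeratorHom a := by
    intro a s
    exact OreLocalization.mul_cancel
  refine ⟨OreLocalization (⊤ : Submonoid M) M, inferInstance,
    OreLocalization.numeratorHom, fun a b hab => ?_, fun g => ?_⟩
  · rw [OreLocalization.numeratorHom_apply, OreLocalization.numeratorHom_apply,
      OreLocalization.oreDiv_eq_iff] at hab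
    obtain ⟨c, d, h1, h2⟩ := hab
    have h2' : (c : M) = d := by simpa using h2
    have h1' : (c : M) * b = d * a := h1
    rw [h2'] at h1'
    exact (mul_left_cancel h1').symm
  · induction g with
    | _ r s =>
    obtain ⟨c, d, hcd⟩ := hcm r s.1
    refine ⟨d, c, ?_⟩
    rw [eq_mul_inv_iff_mul_eq]
    apply (hunit (OreLocalization.numeratorHom (s : M))).mul_left_cancel
    rw [← mul_assoc, hmul, ← map_mul, ← map_mul, hcd]

variable {G : Type v} [Group G] {ι : M →* G}

theorem exists_eq_inv_Delta_pow_mul (hu : ∀ w : M, IsUnit w → w = 1) (hΔ : IsGarside Δ)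
    (hι : IsGroupOfFractions ι) (g : G) : ∃ (n : ℕ) (x : M), g = (ι Δ ^ n)⁻¹ * ι x := by
  obtain ⟨x, y, rfl⟩ := hι.2 g
  obtain ⟨n, c, hc⟩ := exists_dvd_Delta_pow hu hΔ y
  obtain ⟨w, hw⟩ := exists_Delta_pow_mul hu hΔ n (x * c)
  refine ⟨n, w, ?_⟩
  rw [eq_inv_mul_iff_mul_eq, ← mul_assoc, mul_inv_eq_iff_eq_mul, ← map_pow, ← map_mul, ← map_mul]
  congr 1
  apply mul_right_cancel (b := c)
  rw [mul_assoc, mul_assoc, ← hc, hw]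

/-- Every element of the group of fractions is `x⁻¹ Δⁿ`, where `n = 0` or `x` is not a multiple of
`Δ`. -/
theorem exists_eq_inv_mul_Delta_pow (hu : ∀ w : M, IsUnit w → w = 1) (hΔ : IsGarside Δ)
    (hι : IsGroupOfFractions ι) (g : G) :
    ∃ (n : ℕ) (x : M), g = (ι x)⁻¹ * ι Δ ^ n ∧ (n = 0 ∨ ¬ Δ ∣ x) := by
  have h : ∃ (n : ℕ) (x : M), g = (ι x)⁻¹ * ι Δ ^ n := by
    obtain ⟨n, x, hx⟩ := exists_eq_inv_Delta_pow_mul hu hΔ hι g⁻¹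
    refine ⟨n, x, ?_⟩
    rw [← inv_inv g, hx, mul_inv_rev, inv_inv]
  obtain ⟨n, x, hx⟩ := h
  induction n generalizing x with
  | zero => exact ⟨0, x, hx, Or.inl rfl⟩
  | succ n ih =>
    by_cases hd : Δ ∣ x
    · obtain ⟨y, rfl⟩ := hd
      refine ih y ?_
      rw [hx, map_mul, pow_succ']
      group
    · exact ⟨n + 1, x, hx, Or.inr hd⟩

theorem inv_mul_Delta_pow_inj (hι : IsGroupOfFractions ι) {m n : ℕ} {x y : M}
    (h : (ι x)⁻¹ * ι Δ ^ m = (ι y)⁻¹ * ι Δ ^ n) (hx : m = 0 ∨ ¬ Δ ∣ x) (hy : n = 0 ∨ ¬ Δ ∣ y) :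
    m = n ∧ x = y := by
  wlog hmn : m ≤ n generalizing m n x y
  · obtain ⟨h1, h2⟩ := this h.symm hy hx (le_of_not_ge hmn)
    exact ⟨h1.symm, h2.symm⟩
  obtain ⟨k, rfl⟩ := Nat.exists_eq_add_of_le' hmn
  rw [pow_add, ← mul_assoc, mul_left_inj, inv_eq_iff_eq_inv, mul_inv_rev, inv_inv,
    eq_inv_mul_iff_mul_eq, ← map_pow, ← map_mul] at h
  have h' := hι.1 h
  rcases Nat.eq_zero_or_pos k with rfl | hk
  · simpa using h'
  · rcases hy with hy | hy
    · omega
    · refine absurd ?_ hy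
      rw [← h']
      exact (dvd_pow_self Δ hk.ne').mul_right x

theorem zpow_mul_inj (hι : IsGroupOfFractions ι) {m n : ℤ} {x y : M}
    (h : ι Δ ^ (-m) * ι x = ι Δ ^ (-n) * ι y) (hx : ¬ Δ ∣ x) (hy : ¬ Δ ∣ y) :
    m = n ∧ x = y := by
  wlog hmn : m ≤ n generalizing m n x y
  · obtain ⟨h1, h2⟩ := this h.symm hy hx (le_of_not_ge hmn)
    exact ⟨h1.symm, h2.symm⟩
  obtain ⟨k, rfl⟩ := Int.le.dest hmn
  have h1 : ι (Δ ^ k * x) = ι y := by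
    rw [neg_add, zpow_add, zpow_neg, zpow_neg, mul_assoc, mul_right_inj, zpow_natCast,
      eq_inv_mul_iff_mul_eq, ← map_pow, ← map_mul] at h
    exact h
  have h2 := hι.1 h1
  rcases Nat.eq_zero_or_pos k with rfl | hk
  · simpa using h2
  · refine absurd ?_ hy
    rw [← h2]
    exact (dvd_pow_self Δ hk.ne').mul_right x

theorem head?_not_dvd_iff [Nontrivial M] (hu : ∀ w : M, IsUnit w → w = 1) (hΔ : IsGarside Δ)
    {l : List M} (hl : IsReduced Δ l) : (∀ x ∈ l.head?, ¬ Δ ∣ x) ↔ ¬ Δ ∣ l.prod := by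
  rw [← Delta_dvd_headD_iff hu hl]
  cases l with
  | nil => simp [Delta_not_dvd_one hu hΔ]
  | cons x l => simp

theorem existsUnique_isGroupDeltaNormalForm [Nontrivial M] (hu : ∀ w : M, IsUnit w → w = 1)
    (hΔ : IsGarside Δ) (hc : SimpleCommonMultiples Δ) (hι : IsGroupOfFractions ι) (g : G) :
    ∃! p : ℤ × List M, IsGroupDeltaNormalForm ι Δ g p := by
  obtain ⟨n, x, hx⟩ := exists_eq_inv_Delta_pow_mul hu hΔ hι g
  obtain ⟨j, y, rfl, hy⟩ := exists_eq_Delta_pow_mul hu hΔ x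
  obtain ⟨l, hl, rfl⟩ := exists_isReduced hu hΔ y
  have hg : g = ι Δ ^ (-((n : ℤ) - j)) * ι l.prod := by
    rw [hx, map_mul, map_pow, ← mul_assoc, neg_sub, sub_eq_neg_add, zpow_add, zpow_neg,
      zpow_natCast, zpow_natCast]
  refine ⟨((n : ℤ) - j, l), ⟨hg, hl.1, hl.2, (head?_not_dvd_iff hu hΔ hl).mpr hy⟩, ?_⟩
  rintro ⟨k, m⟩ ⟨hg', hm1, hm2, hm3⟩
  have hm : IsReduced Δ m := ⟨hm1, hm2⟩
  obtain ⟨h1, h2⟩ := zpow_mul_inj hι (hg'.symm.trans hg) ((head?_not_dvd_iff hu hΔ hm).mp hm3) hy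
  exact Prod.ext h1 (hm.unique hu hc hl h2)

end Fractions

/-! ### Regular languages -/

section Regular

/-- Myhill–Nerode criterion: a language is regular if the words that can be completed to words of
`L` are distributed into finitely many classes, two words of the same class having the same
completions. -/
theorem isRegular_of_finite_image {α : Type u} {σ : Type v} {L : Language α} (f : List α → σ)
    (hfin : (f '' {u | ∃ v, u ++ v ∈ L}).Finite)
    (h : ∀ u u' v w, f u = f u' → u' ++ w ∈ L → u ++ v ∈ L → u' ++ v ∈ L) : L.IsRegular := by
  apply Language.IsRegular.of_finite_range_leftQuotient
  refine ((hfin.image fun s => {v | ∃ u, f u = s ∧ u ++ v ∈ L}).insert ∅).subset ?_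
  rintro _ ⟨u, rfl⟩
  by_cases hu : ∃ v, u ++ v ∈ L
  · refine Or.inr ⟨f u, ⟨u, hu, rfl⟩, ?_⟩
    obtain ⟨w, hw⟩ := hu
    ext v
    exact ⟨fun ⟨u', he, hv⟩ => h u' u v w he hw hv, fun hv => ⟨u, rfl, hv⟩⟩
  · refine Or.inl (Set.eq_empty_iff_forall_notMem.mpr fun v hv => hu ⟨v, hv⟩)

/-- A prefix-closed language such that appending a letter to one of its words is controlled by the
last letter of the word only is regular. -/
theorem isRegular_of_local {α : Type u} [Finite α] {L : Language α}
    (hpre : ∀ u v, u ++ v ∈ L → u ∈ L)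
    (h : ∀ u u' a b, u ++ [a, b] ∈ L → u' ++ [a] ∈ L → u' ++ [a, b] ∈ L) : L.IsRegular := by
  refine isRegular_of_finite_image (fun u => u.getLast?) (Set.toFinite _) ?_
  intro u u' v w he hw hv
  replace hw := hpre _ _ hw
  induction v generalizing u u' with
  | nil => simpa using hw
  | cons b v ih =>
    rw [List.append_cons] at hv ⊢
    refine ih (u ++ [b]) (u' ++ [b]) (by simp) hv ?_
    have hub := hpre _ _ hv
    rcases List.eq_nil_or_concat u with rfl | ⟨t, a, rfl⟩
    · have : u' = [] := by simpa using he.symm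
      rwa [this]
    · rcases List.eq_nil_or_concat u' with rfl | ⟨t', a', rfl⟩
      · simp at he
      · obtain rfl : a = a' := by simpa using he
        simp only [List.concat_eq_append, List.append_assoc, List.cons_append,
          List.nil_append] at hub hw ⊢
        exact h t t' a b hub hw

variable {A : Type}

@[simp]
theorem paddedPair_nil_left (w : List A) :
    paddedPair [] w = w.map fun a => (none, some a) := by
  simp [paddedPair]

@[simp]
theorem paddedPair_nil_right (w : List A) :
    paddedPair w [] = w.map fun a => (some a, none) := by
  simp [paddedPair]

@[simp]
theorem paddedPair_cons_cons (a b : A) (v w : List A) :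
    paddedPair (a :: v) (b :: w) = (some a, some b) :: paddedPair v w := rfl

theorem take_paddedPair (n : ℕ) (v w : List A) :
    (paddedPair v w).take n = paddedPair (v.take n) (w.take n) := by
  induction n generalizing v w with
  | zero => simp
  | succ n ih => cases v <;> cases w <;> simp [ih, List.map_take]

theorem drop_paddedPair (n : ℕ) (v w : List A) :
    (paddedPair v w).drop n = paddedPair (v.drop n) (w.drop n) := by
  induction n generalizing v w with
  | zero => simp
  | succ n ih => cases v <;> cases w <;> simp [ih, List.map_drop]

theorem length_paddedPair (v w : List A) :
    (paddedPair v w).length = max v.length w.length := by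
  induction v generalizing w with
  | nil => simp
  | cons a v ih => cases w <;> simp [ih]

theorem paddedPair_append {v w v' w' : List A} (h : v.length < w.length → v' = [])
    (h' : w.length < v.length → w' = []) :
    paddedPair v w ++ paddedPair v' w' = paddedPair (v ++ v') (w ++ w') := by
  induction v generalizing w with
  | nil =>
    cases w with
    | nil => simp
    | cons b w => simp [h (by simp)]
  | cons a v ih =>
    cases w with
    | nil => simp [h' (by simp)]
    | cons b w =>
      simp only [List.length_cons, add_lt_add_iff_right] at h h'
      simp [ih h h']

/-- The first tape of a two-tape word. -/
def tapeFst (u : List (Option A × Option A)) : List A := (u.map Prod.fst).reduceOption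

/-- The second tape of a two-tape word. -/
def tapeSnd (u : List (Option A × Option A)) : List A := (u.map Prod.snd).reduceOption

@[simp]
theorem tapeFst_paddedPair (v w : List A) : tapeFst (paddedPair v w) = v := by
  induction v generalizing w with
  | nil =>
    simp only [tapeFst, paddedPair_nil_left]
    induction w <;> simp_all
  | cons a v ih =>
    cases w with
    | nil =>
      have := ih []
      simp_all [tapeFst]
    | cons b w =>
      have := ih w
      simp_all [tapeFst]

@[simp]
theorem tapeSnd_paddedPair (v w : List A) : tapeSnd (paddedPair v w) = w := by
  induction w generalizing v with
  | nil =>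
    simp only [tapeSnd, paddedPair_nil_right]
    induction v <;> simp_all
  | cons a w ih =>
    cases v with
    | nil =>
      have := ih []
      simp_all [tapeSnd]
    | cons b v =>
      have := ih v
      simp_all [tapeSnd]

variable {G : Type v} [Group G]

@[simp]
theorem wordEval_append (π : A → G) (v w : List A) :
    wordEval π (v ++ w) = wordEval π v * wordEval π w := by
  simp [wordEval]

/-- `g` has the fellow traveler property for `L` if, whenever `w₁, w₂ ∈ L` satisfy `w₁ g = w₂`,
the prefixes of `w₁` and `w₂` of equal lengths stay within a fixed finite set of each other. -/
def FellowTravels (π : A → G) (L : Language A) (g : G) : Prop :=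
  ∃ B : Set G, B.Finite ∧ ∀ w₁ ∈ L, ∀ w₂ ∈ L, wordEval π w₁ * g = wordEval π w₂ →
    ∀ t, (wordEval π (w₁.take t))⁻¹ * wordEval π (w₂.take t) ∈ B

/-- A two-tape automaton recognizing multiplication by `g` has to remember the states reached on
both tapes in an automaton for `L`, the difference of the two prefixes, and which tape, if any, is
being padded. -/
theorem FellowTravels.isRegular {π : A → G} {L : Language A} (hL : L.IsRegular) {g : G}
    (hg : FellowTravels π L g) : (multiplierLanguage π L g).IsRegular := by
  obtain ⟨B, hB, hft⟩ := hg
  have hq := hL.finite_range_leftQuotient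
  refine isRegular_of_finite_image (fun u => (L.leftQuotient (tapeFst u),
    L.leftQuotient (tapeSnd u), (wordEval π (tapeFst u))⁻¹ * wordEval π (tapeSnd u),
    (tapeFst u).length < (tapeSnd u).length, (tapeSnd u).length < (tapeFst u).length)) ?_ ?_
  · refine (hq.prod (hq.prod (hB.prod (Set.finite_univ (α := Prop × Prop))))).subset ?_
    rintro _ ⟨u, ⟨v, w₁, h₁, w₂, h₂, he, huv⟩, rfl⟩
    have hu : u = paddedPair (w₁.take u.length) (w₂.take u.length) := by
      rw [← take_paddedPair, ← huv, List.take_left]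
    refine ⟨⟨_, rfl⟩, ⟨_, rfl⟩, ?_, trivial⟩
    dsimp only
    rw [hu, tapeFst_paddedPair, tapeSnd_paddedPair]
    exact hft w₁ h₁ w₂ h₂ he _
  · rintro u u' v v' hs ⟨w₁', -, w₂', -, -, huv'⟩ ⟨w₁, h₁, w₂, h₂, he, huv⟩
    have hu : u = paddedPair (w₁.take u.length) (w₂.take u.length) := by
      rw [← take_paddedPair, ← huv, List.take_left]
    have hv : v = paddedPair (w₁.drop u.length) (w₂.drop u.length) := by
      rw [← drop_paddedPair, ← huv, List.drop_left]
    have hu' : u' = paddedPair (w₁'.take u'.length) (w₂'.take u'.length) := by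
      rw [← take_paddedPair, ← huv', List.take_left]
    have hlen : u.length = max (w₁.take u.length).length (w₂.take u.length).length := by
      rw [← length_paddedPair, ← hu]
    have e₁ := List.take_append_drop u.length w₁
    have e₂ := List.take_append_drop u.length w₂
    have d₁ := List.length_drop (i := u.length) (l := w₁)
    have d₂ := List.length_drop (i := u.length) (l := w₂)
    rw [List.length_take, List.length_take] at hlen
    have k₁ : (w₁.take u.length).length < (w₂.take u.length).length → w₁.drop u.length = [] := by
      rw [List.length_take, List.length_take, List.drop_eq_nil_iff]
      omega
    have k₂ : (w₂.take u.length).length < (w₁.take u.length).length → w₂.drop u.length = [] := by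
      rw [List.length_take, List.length_take, List.drop_eq_nil_iff]
      omega
    generalize w₁.take u.length = a at *
    generalize w₂.take u.length = b at *
    generalize w₁.drop u.length = c at *
    generalize w₂.drop u.length = d at *
    generalize w₁'.take u'.length = a' at *
    generalize w₂'.take u'.length = b' at *
    subst hu hv hu' e₁ e₂
    simp only [tapeFst_paddedPair, tapeSnd_paddedPair, Prod.mk.injEq, eq_iff_iff] at hs
    obtain ⟨hs₁, hs₂, hs₃, hs₄, hs₅⟩ := hs
    refine ⟨a' ++ c, ?_, b' ++ d, ?_, ?_, ?_⟩
    · rw [← Language.mem_leftQuotient, ← hs₁]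
      exact h₁
    · rw [← Language.mem_leftQuotient, ← hs₂]
      exact h₂
    · rw [wordEval_append, wordEval_append, mul_assoc] at he ⊢
      rw [← eq_inv_mul_iff_mul_eq, ← mul_assoc] at he ⊢
      rw [he, hs₃]
    · exact paddedPair_append (fun h => k₁ (hs₄.mpr h)) fun h => k₂ (hs₅.mpr h)

theorem FellowTravels.mul {π : A → G} {L : Language A} (hL : ∀ g, ∃ w ∈ L, wordEval π w = g)
    {g h : G} (hg : FellowTravels π L g) (hh : FellowTravels π L h) :
    FellowTravels π L (g * h) := by
  obtain ⟨B, hB, hgB⟩ := hg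
  obtain ⟨C, hC, hhC⟩ := hh
  refine ⟨Set.image2 (· * ·) B C, hB.image2 _ hC, fun w₁ h₁ w₂ h₂ he t => ?_⟩
  obtain ⟨w, hw, hwe⟩ := hL (wordEval π w₁ * g)
  refine ⟨_, hgB w₁ h₁ w hw hwe.symm t, _, hhC w hw w₂ h₂ (by rw [hwe, mul_assoc, he]) t, ?_⟩
  group

theorem FellowTravels.inv {π : A → G} {L : Language A} {g : G} (hg : FellowTravels π L g) :
    FellowTravels π L g⁻¹ := by
  obtain ⟨B, hB, hgB⟩ := hg
  refine ⟨(·⁻¹) '' B, hB.image _, fun w₁ h₁ w₂ h₂ he t => ?_⟩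
  exact ⟨_, hgB w₂ h₂ w₁ h₁ (by rw [← he, inv_mul_cancel_right]) t, by group⟩

theorem fellowTravels_one {π : A → G} {L : Language A} (hL : Set.InjOn (wordEval π) L) :
    FellowTravels π L 1 := by
  refine ⟨{1}, Set.finite_singleton 1, fun w₁ h₁ w₂ h₂ he t => ?_⟩
  rw [mul_one] at he
  simp [hL h₁ h₂ he]

theorem isAutomatic_of_fellowTravels [Fintype A] {π : A → G} {L : Language A} (hL : L.IsRegular)
    (hsurj : ∀ g, ∃ w ∈ L, wordEval π w = g) (hft : ∀ g, FellowTravels π L g) : IsAutomatic G :=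
  ⟨A, inferInstance, π, L, hL, hsurj, (hft 1).isRegular hL, fun a => (hft (π a)).isRegular hL⟩

theorem isAutomatic_of_subsingleton [Subsingleton G] : IsAutomatic G := by
  have hL : (⊤ : Language Empty).IsRegular :=
    isRegular_of_local (fun _ _ _ => trivial) (fun _ _ _ _ _ _ => trivial)
  refine isAutomatic_of_fellowTravels (π := fun _ => (1 : G)) hL
    (fun g => ⟨[], trivial, Subsingleton.elim _ _⟩) fun g => ?_
  exact ⟨{1}, Set.finite_singleton 1, fun _ _ _ _ _ _ => Subsingleton.elim _ _⟩

end Regular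

/-! ### The automatic structure -/

section Structure

variable {M : Type u} [CancelMonoid M] {Δ : M} {A : Type} {σ : A → M}

/-- The word `xₚ ⋯ x₁ Δᵏ` over the alphabet `Option A`, for `l = (x₁, …, xₚ)`; the letter `none`
stands for `Δ`, and `some a` stands for the inverse of the element of `M` coded by `a`. -/
def fracWord (l : List A) (k : ℕ) : List (Option A) :=
  (l.map some).reverse ++ List.replicate k none

/-- The evaluation of the letters of `fracWord` in a group of fractions. -/
def fracEval {G : Type v} [Group G] (ι : M →* G) (Δ : M) (σ : A → M) : Option A → G
  | none => ι Δ
  | some a => (ι (σ a))⁻¹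

/-- The language of the words coding the expressions `x⁻¹ Δᵏ` where `x` is given by its normal form
and either `k = 0` or `x` is not a multiple of `Δ`. -/
def fracLanguage (Δ : M) (σ : A → M) : Language (Option A) :=
  {w | ∃ l k, w = fracWord l k ∧ IsReduced Δ (l.map σ) ∧ (k = 0 ∨ ¬ Δ ∣ (l.map σ).prod)}

theorem take_fracWord (l : List A) (k t : ℕ) :
    (fracWord l k).take t = fracWord (l.drop (l.length - t)) (min (t - l.length) k) := by
  rw [fracWord, fracWord, List.take_append, List.take_reverse, List.take_replicate]
  simp

theorem reverse_fracWord (l : List A) (k : ℕ) :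
    (fracWord l k).reverse = List.replicate k none ++ l.map some := by
  simp [fracWord]

theorem mem_fracLanguage_of_append {u v : List (Option A)}
    (h : u ++ v ∈ fracLanguage Δ σ) : u ∈ fracLanguage Δ σ := by
  obtain ⟨l, k, he, hl, hk⟩ := h
  refine ⟨l.drop (l.length - u.length), min (u.length - l.length) k, ?_, ?_, ?_⟩
  · rw [← take_fracWord, ← he, List.take_left]
  · rw [List.map_drop]
    exact hl.drop _
  · rcases hk with rfl | hk
    · simp
    · rcases le_or_gt u.length l.length with h | h
      · left
        omega
      · right
        rwa [show l.length - u.length = 0 by omega, List.drop_zero]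

/-- Whether a word belongs to the language only depends on its pairs of consecutive letters. -/
theorem isRegular_fracLanguage [Finite A] (hu : ∀ w : M, IsUnit w → w = 1) (hΔ : IsGarside Δ) :
    (fracLanguage Δ σ).IsRegular := by
  refine isRegular_of_local (fun _ _ => mem_fracLanguage_of_append) ?_
  rintro u u' a b ⟨l, k, he, hl, hk⟩ ⟨l', k', he', hl', hk'⟩
  suffices h : ∃ (m : List A) (j : ℕ), b :: a :: u'.reverse = List.replicate j none ++ m.map some ∧
      IsReduced Δ (m.map σ) ∧ (j = 0 ∨ ¬ Δ ∣ (m.map σ).prod) by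
    obtain ⟨m, j, h, hm⟩ := h
    refine ⟨m, j, List.reverse_injective ?_, hm⟩
    rw [reverse_fracWord, ← h]
    simp
  replace he := congrArg List.reverse he
  replace he' := congrArg List.reverse he'
  rw [reverse_fracWord] at he he'
  simp only [List.reverse_append, List.reverse_cons, List.reverse_nil, List.nil_append,
    List.cons_append] at he he'
  rw [he']
  cases b with
  | some j =>
    -- Both letters are inverses of simple elements.
    cases k with
    | succ k => simp [List.replicate_succ] at he
    | zero =>
    rcases l with _ | ⟨j', _ | ⟨i, l⟩⟩
    · simp at he
    · simp at he
    obtain ⟨hj, ha, -⟩ : j = j' ∧ a = some i ∧ u.reverse = l.map some := by simpa using he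
    subst hj ha
    cases k' with
    | succ k' => simp [List.replicate_succ] at he'
    | zero =>
    rcases l' with _ | ⟨i', l'⟩
    · simp at he'
    obtain ⟨hi, -⟩ : i = i' ∧ u'.reverse = l'.map some := by simpa using he'
    subst hi
    exact ⟨j :: i :: l', 0, by simp, isReduced_cons_cons_of_head hu hΔ hl hl', Or.inl rfl⟩
  | none =>
    cases k with
    | zero => rcases l with _ | ⟨i, l⟩ <;> simp at he
    | succ k =>
    refine ⟨l', k' + 1, by simp [List.replicate_succ], hl', Or.inr ?_⟩
    cases a with
    | none =>
      cases k' with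
      | zero => rcases l' with _ | ⟨i, l'⟩ <;> simp at he'
      | succ k' => exact hk'.resolve_left k'.succ_ne_zero
    | some i =>
      cases k with
      | succ k => simp [List.replicate_succ] at he
      | zero =>
      rcases l with _ | ⟨i₁, l⟩
      · simp at he
      obtain ⟨hi, -⟩ : i = i₁ ∧ u.reverse = l.map some := by simpa [List.replicate_succ] using he
      subst hi
      cases k' with
      | succ k' => simp [List.replicate_succ] at he'
      | zero =>
      rcases l' with _ | ⟨i₂, l'⟩
      · simp at he'
      obtain ⟨hi, -⟩ : i = i₂ ∧ u'.reverse = l'.map some := by simpa using he'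
      subst hi
      rw [← Delta_dvd_headD_iff hu hl']
      have := hk.resolve_left (Nat.succ_ne_zero _)
      rwa [← Delta_dvd_headD_iff hu hl] at this

/-- Distinct letters code distinct elements, and every nontrivial `Δ`-simple element is coded. -/
structure IsCoding (Δ : M) (σ : A → M) : Prop where
  injective : Function.Injective σ
  exists_eq : ∀ x, IsDeltaSimple Δ x → x ≠ 1 → ∃ a, σ a = x

theorem IsCoding.exists_map_eq (hσ : IsCoding Δ σ) {l : List M} (hl : IsReduced Δ l) :
    ∃ l' : List A, l'.map σ = l := by
  induction l with
  | nil => exact ⟨[], rfl⟩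
  | cons x l ih =>
    obtain ⟨hx, hx1, hl'⟩ := isReduced_cons.mp hl
    obtain ⟨a, rfl⟩ := hσ.exists_eq x hx.simple hx1
    obtain ⟨l', rfl⟩ := ih hl'
    exact ⟨a :: l', rfl⟩

theorem exists_isCoding (hu : ∀ w : M, IsUnit w → w = 1) (hΔ : IsGarside Δ) :
    ∃ (n : ℕ) (σ : Fin n → M), IsCoding Δ σ := by
  have hfin : Finite {x : M | IsDeltaSimple Δ x} := finite_isDeltaSimple hu hΔ
  obtain ⟨n, ⟨e⟩⟩ := Finite.exists_equiv_fin {x : M | IsDeltaSimple Δ x}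
  refine ⟨n, fun i => e.symm i, Subtype.val_injective.comp e.symm.injective, fun x hx _ => ?_⟩
  exact ⟨e ⟨x, hx⟩, by simp⟩

variable {G : Type v} [Group G] {ι : M →* G}

theorem wordEval_fracWord (ι : M →* G) (Δ : M) (σ : A → M) (l : List A) (k : ℕ) :
    wordEval (fracEval ι Δ σ) (fracWord l k) = (ι (l.map σ).prod)⁻¹ * ι Δ ^ k := by
  rw [fracWord, wordEval_append]
  congr 1
  · induction l with
    | nil => simp [wordEval]
    | cons a l ih =>
      rw [List.map_cons, List.reverse_cons, wordEval_append, ih]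
      simp [wordEval, fracEval]
  · simp [wordEval, fracEval]

theorem exists_mem_fracLanguage (hu : ∀ w : M, IsUnit w → w = 1) (hΔ : IsGarside Δ)
    (hι : IsGroupOfFractions ι) (hσ : IsCoding Δ σ) (g : G) :
    ∃ w ∈ fracLanguage Δ σ, wordEval (fracEval ι Δ σ) w = g := by
  obtain ⟨n, x, rfl, hx⟩ := exists_eq_inv_mul_Delta_pow hu hΔ hι g
  obtain ⟨l, hl, rfl⟩ := exists_isReduced hu hΔ x
  obtain ⟨l, rfl⟩ := hσ.exists_map_eq hl
  exact ⟨fracWord l n, ⟨l, n, rfl, hl, hx⟩, wordEval_fracWord ι Δ σ l n⟩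

theorem injOn_wordEval_fracLanguage (hu : ∀ w : M, IsUnit w → w = 1)
    (hc : SimpleCommonMultiples Δ) (hι : IsGroupOfFractions ι) (hσ : IsCoding Δ σ) :
    Set.InjOn (wordEval (fracEval ι Δ σ)) (fracLanguage Δ σ) := by
  rintro _ ⟨l, k, rfl, hl, hk⟩ _ ⟨m, j, rfl, hm, hj⟩ he
  rw [wordEval_fracWord, wordEval_fracWord] at he
  obtain ⟨rfl, h⟩ := inv_mul_Delta_pow_inj hι he hk hj
  rw [hσ.injective.list_map (hl.unique hu hc hm h)]

/-- A finite set bounding the distance between the prefixes of the words coding `g` and `g s⁻¹`,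
for `s ∣ Δ`. -/
def travelSet (ι : M →* G) (Δ : M) : Set G :=
  (fun p : (M × M) × ℤ => ι p.1.1 * (ι p.1.2)⁻¹ * ι Δ ^ p.2) ''
    ((Div (Δ ^ (Div Δ).ncard) ×ˢ Div (Δ ^ (Div Δ).ncard)) ×ˢ Set.Icc (-1) 1)

theorem finite_travelSet (hu : ∀ w : M, IsUnit w → w = 1) (hΔ : IsGarside Δ) (ι : M →* G) :
    (travelSet ι Δ).Finite :=
  Set.Finite.image _ (((finite_Div_Delta_pow hΔ _ hu).prod (finite_Div_Delta_pow hΔ _ hu)).prod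
    (Set.finite_Icc _ _))

theorem exists_conj_Delta_pow (hu : ∀ w : M, IsUnit w → w = 1) (hΔ : IsGarside Δ) (ι : M →* G)
    {n : ℕ} (a : ℕ) {x : M} (hx : x ∣ Δ ^ n) :
    ∃ y, y ∣ Δ ^ n ∧ ι x = ι Δ ^ a * ι y * (ι Δ ^ a)⁻¹ := by
  induction a with
  | zero => exact ⟨x, hx, by simp⟩
  | succ a ih =>
    obtain ⟨y, hy, he⟩ := ih
    obtain ⟨z, hz⟩ := exists_mul_Delta hu hΔ y
    refine ⟨z, dvd_Delta_pow_of_mul_Delta_eq hu hΔ hy hz, ?_⟩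
    have hz' : ι y = ι Δ * ι z * (ι Δ)⁻¹ := by
      rw [eq_mul_inv_iff_mul_eq, ← map_mul, ← map_mul, hz]
    rw [he, hz', pow_succ]
    group

/-- Conjugation by `Δ` preserves the set of divisors of a power of `Δ`, so that powers of `Δ` at
the ends of two words contribute to their distance through the difference of the exponents only. -/
theorem mem_travelSet (hu : ∀ w : M, IsUnit w → w = 1) (hΔ : IsGarside Δ) (ι : M →* G)
    {x y r : M} (hx : x ∣ Δ ^ (Div Δ).ncard) (hy : y ∣ Δ ^ (Div Δ).ncard) {a b : ℕ}
    (hab : a ≤ b + 1) (hba : b ≤ a + 1) :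
    ((ι (x * r))⁻¹ * ι Δ ^ a)⁻¹ * ((ι (y * r))⁻¹ * ι Δ ^ b) ∈ travelSet ι Δ := by
  obtain ⟨x', hx', ex⟩ := exists_conj_Delta_pow hu hΔ ι a hx
  obtain ⟨y', hy', ey⟩ := exists_conj_Delta_pow hu hΔ ι a hy
  refine ⟨((x', y'), (b : ℤ) - a), ⟨⟨hx', hy'⟩, by constructor <;> omega⟩, ?_⟩
  dsimp only
  rw [map_mul, map_mul, ex, ey, sub_eq_neg_add, zpow_add, zpow_neg, zpow_natCast, zpow_natCast]
  group

theorem exists_common_tail (hu : ∀ w : M, IsUnit w → w = 1) (hΔ : IsGarside Δ)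
    {l m : List M} (hl : IsReduced Δ l)
    (h : ∀ i, ∃ c, (m.drop i).prod = c * (l.drop i).prod ∧ c ∣ Δ ^ (Div Δ).ncard) {i j : ℕ}
    (hij : j = i ∨ j = i + 1) :
    ∃ x y r, x ∣ Δ ^ (Div Δ).ncard ∧ y ∣ Δ ^ (Div Δ).ncard ∧
      (l.drop i).prod = x * r ∧ (m.drop j).prod = y * r := by
  obtain ⟨c, hcm, hcΔ⟩ := h j
  rcases hij with rfl | rfl
  · exact ⟨1, c, _, one_dvd _, hcΔ, (one_mul _).symm, hcm⟩
  · refine ⟨(l.drop i).headD 1, c, _, ((hl.drop i).isHead hu).simple.dvd_Delta_pow hu hΔ, hcΔ, ?_,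
      hcm⟩
    rw [← List.tail_drop, headD_mul_prod_tail]

theorem isHead_Delta_mul (hu : ∀ w : M, IsUnit w → w = 1) (y : M) : IsHead Δ Δ (Δ * y) := by
  refine ⟨dvd_mul_right _ _, fun x hx he => ?_, ?_⟩
  · have h : Δ ∈ Div x ∩ Div Δ := he ▸ ⟨dvd_refl Δ, dvd_refl Δ⟩
    exact hx.ne (dvd_antisymm_of_units hu hx.dvd h.1)
  · rw [Set.inter_self]
    exact (Set.inter_eq_right.mpr (Div_subset (dvd_mul_right _ _))).symm

/-- The word for `g s⁻¹`, where `g = x⁻¹ Δᵏ`, comes from the normal form of `s' x` with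
`s' = Δᵏ s Δ⁻ᵏ`; when `k > 0` and `Δ` divides `s' x`, the entry `Δ` of this normal form cancels
with a letter of `Δᵏ`. -/
theorem fellowTravels_inv_of_dvd_Delta [Nontrivial M] (hu : ∀ w : M, IsUnit w → w = 1)
    (hΔ : IsGarside Δ) (hc : SimpleCommonMultiples Δ) (hι : IsGroupOfFractions ι) {s : M}
    (hs : s ∣ Δ) : FellowTravels (fracEval ι Δ σ) (fracLanguage Δ σ) (ι s)⁻¹ := by
  refine ⟨travelSet ι Δ, finite_travelSet hu hΔ ι, ?_⟩
  rintro _ ⟨l, k, rfl, hl, hk⟩ _ ⟨m, k', rfl, hm, hk'⟩ he t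
  rw [take_fracWord, take_fracWord, wordEval_fracWord, wordEval_fracWord, List.map_drop,
    List.map_drop]
  rw [wordEval_fracWord, wordEval_fracWord] at he
  obtain ⟨s', hs', hss'⟩ := exists_Delta_pow_mul_of_dvd hu hΔ k hs
  have he' : (ι (s' * (l.map σ).prod))⁻¹ * ι Δ ^ k = (ι (m.map σ).prod)⁻¹ * ι Δ ^ k' := by
    have h1 : ι s' * ι Δ ^ k = ι Δ ^ k * ι s := by rw [← map_pow, ← map_mul, hss', map_mul]
    have h2 : ι s' = ι Δ ^ k * ι s * (ι Δ ^ k)⁻¹ := by rw [← h1, mul_inv_cancel_right]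
    rw [← he, map_mul, h2]
    group
  rw [← l.length_map σ, ← m.length_map σ]
  generalize l.map σ = l at *
  generalize m.map σ = m at *
  by_cases hk1 : k = 0 ∨ ¬ Δ ∣ s' * l.prod
  · obtain ⟨rfl, h⟩ := inv_mul_Delta_pow_inj hι he' hk1 hk'
    obtain ⟨hlen, hft⟩ := hl.exists_drop_of_dvd_Delta hu hΔ hc hm h.symm hs'
    obtain ⟨x, y, r, hx, hy, h1, h2⟩ := exists_common_tail hu hΔ hl hft
      (show m.length - t = l.length - t ∨ m.length - t = l.length - t + 1 by omega)
    rw [h1, h2]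
    exact mem_travelSet hu hΔ ι hx hy (by omega) (by omega)
  · push Not at hk1
    obtain ⟨hk0, y, hy⟩ := hk1
    obtain ⟨j, rfl⟩ := Nat.exists_eq_succ_of_ne_zero hk0
    have hyΔ : ¬ Δ ∣ y := by
      rintro ⟨z, rfl⟩
      obtain ⟨c, hc'⟩ := hs'
      obtain ⟨c', hcc⟩ := exists_mul_Delta hu hΔ c
      refine hk.resolve_left hk0 ⟨c' * z, mul_left_cancel (a := s') ?_⟩
      rw [hy, ← mul_assoc Δ c' z, ← hcc]
      nth_rw 1 [hc']
      simp only [mul_assoc]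
    rw [hy, map_mul, mul_inv_rev, Nat.succ_eq_add_one, pow_succ', mul_assoc,
      inv_mul_cancel_left] at he'
    obtain ⟨rfl, rfl⟩ := inv_mul_Delta_pow_inj hι he' (Or.inr hyΔ) hk'
    have hΔm : IsReduced Δ (Δ :: m) :=
      isReduced_cons.mpr ⟨isHead_Delta_mul hu _, Delta_ne_one hu hΔ, hm⟩
    obtain ⟨hlen, hft⟩ := hl.exists_drop_of_dvd_Delta hu hΔ hc hΔm
      (by rw [List.prod_cons, hy]) hs'
    rw [List.length_cons] at hlen
    obtain ⟨x, y, r, hx, hy, h1, h2⟩ := exists_common_tail hu hΔ hl hft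
      (show m.length - t + 1 = l.length - t ∨ m.length - t + 1 = l.length - t + 1 by omega)
    rw [List.drop_succ_cons] at h2
    rw [h1, h2]
    exact mem_travelSet hu hΔ ι hx hy (by omega) (by omega)

theorem fellowTravels_fracLanguage [Nontrivial M] (hu : ∀ w : M, IsUnit w → w = 1)
    (hΔ : IsGarside Δ) (hc : SimpleCommonMultiples Δ) (hι : IsGroupOfFractions ι)
    (hσ : IsCoding Δ σ) (g : G) : FellowTravels (fracEval ι Δ σ) (fracLanguage Δ σ) g := by
  have hsurj := exists_mem_fracLanguage hu hΔ hι hσ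
  have hM : ∀ x : M, FellowTravels (fracEval ι Δ σ) (fracLanguage Δ σ) (ι x) := by
    intro x
    have hx : x ∈ Submonoid.closure (Div Δ) := by rw [hΔ.2.generates]; trivial
    induction hx using Submonoid.closure_induction_left with
    | one =>
      rw [map_one]
      exact fellowTravels_one (injOn_wordEval_fracLanguage hu hc hι hσ)
    | mul_left s hs x _ ih =>
      rw [map_mul]
      refine FellowTravels.mul hsurj ?_ ih
      simpa using (fellowTravels_inv_of_dvd_Delta hu hΔ hc hι hs).inv
  obtain ⟨x, y, rfl⟩ := hι.2 g
  exact (hM x).mul hsurj (hM y).inv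

theorem isAutomatic_of_isGroupOfFractions (hu : ∀ w : M, IsUnit w → w = 1) (hΔ : IsGarside Δ)
    (hc : SimpleCommonMultiples Δ) (hι : IsGroupOfFractions ι) : IsAutomatic G := by
  rcases subsingleton_or_nontrivial M with hM | hM
  · have : Subsingleton G := by
      refine subsingleton_of_forall_eq 1 fun g => ?_
      obtain ⟨x, y, rfl⟩ := hι.2 g
      rw [Subsingleton.elim x y, mul_inv_cancel]
    exact isAutomatic_of_subsingleton
  · obtain ⟨n, σ, hσ⟩ := exists_isCoding hu hΔ
    exact isAutomatic_of_fellowTravels (isRegular_fracLanguage hu hΔ)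
      (exists_mem_fracLanguage hu hΔ hι hσ) (fellowTravels_fracLanguage hu hΔ hc hι hσ)

end Structure

end ThinMonoid

theorem mainTheorem10 (M : Type u) [CancelMonoid M]
    (hthin : ThinMonoid.IsThin M)
    (hunit : ∀ w : M, IsUnit w → w = 1)
    (Δ : M) (hΔ : ThinMonoid.IsGarside Δ)
    (hcond : ∀ x x' : M, ThinMonoid.IsDeltaSimple Δ x → ThinMonoid.IsDeltaSimple Δ x' → x ≠ x' →
      ThinMonoid.Div x ∩ ThinMonoid.Div Δ = ThinMonoid.Div x' ∩ ThinMonoid.Div Δ →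
      ∀ z : M, x ∣ z → x' ∣ z →
        ∃ w : M, ThinMonoid.IsDeltaSimple Δ w ∧ x ∣ w ∧ x' ∣ w ∧ w ∣ z) :
    (∀ x : M, ∃! l : List M, ThinMonoid.IsDeltaNormalForm Δ x l) ∧
    (∃ (G : Type u) (_ : Group G) (ι : M →* G), ThinMonoid.IsGroupOfFractions ι) ∧
    ∀ (G : Type v) [Group G] (ι : M →* G), ThinMonoid.IsGroupOfFractions ι →
      (Nontrivial M → ∀ g : G, ∃! p : ℤ × List M,
        ThinMonoid.IsGroupDeltaNormalForm ι Δ g p) ∧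
      ThinMonoid.IsAutomatic G := by
  exact ⟨ThinMonoid.existsUnique_isDeltaNormalForm hunit hΔ hcond,
    ThinMonoid.exists_groupOfFractions hunit hΔ, fun _ _ _ hι =>
      ⟨fun _ => ThinMonoid.existsUnique_isGroupDeltaNormalForm hunit hΔ hcond hι,
        ThinMonoid.isAutomatic_of_isGroupOfFractions hunit hΔ hcond hι⟩⟩
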